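/- **Theorem.** A *Motzkin tree* is a rooted plane unary-binary tree: each node is a leaf, a unary node, or a binary node with a left and a right child. Its size $|T|$ is its total number of nodes, and $M_n$ is the number of Motzkin trees of size $n$. A *colour-pointed tree* is a Motzkin tree with a blue pointed leaf, a red pointed leaf, or a green pointed unary node. *Repointing* a colour-pointed tree $T$ gives a node $v$ of $T$, or $v=\bot$, as follows; the root counts as a right child, and a node counts among its own ancestors. If $T$ has a blue leaf, then $v$ is the first ancestor of that leaf (going up) that is a left child, and $v=\bot$ if there is none. If $T$ has a red leaf, then $v$ is the first ancestor of that leaf that is a right child. If $T$ has a green unary node, then $v$ is its child. *Grafts.* $G1$ acts on a colour-pointed tree: a blue or red leaf gets a new unary node as its father and keeps its colour; a green unary node becomes binary, its child becomes its left child, and its right child is a new red pointed leaf. $G2,\dots,G5$ act on a tree with a pointed node $v$: $G2$ inserts a new green pointed unary node as the father of $v$; $G3$, $G4$, $G5$ insert a new binary node as the father of $v$, whose other child is a new pointed leaf, namely a blue right child for $G3$, a red left child for $G4$, and a blue left child for $G5$. *Try($n$).* Start with a tree reduced to one leaf, coloured blue or red with probability $1/2$ each. While $|T|<n$, choose one of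 $G1,\dots,G5$ with probabilities $\frac13,\frac13,\frac19,\frac19,\frac19$; if it is $G1$, replace $T$ by $G1(T)$; otherwise repoint $T$, return FAIL if $v=\bot$, and else apply the chosen graft to $(T,v)$. Finally return $T$. All random choices are independent. *Sampler($n$).* Run Try($n$) repeatedly, with fresh randomness, until it returns neither FAIL nor a tree of size $n+1$; output the tree that was returned, forgetting its point. *Running time* is the total number of elementary steps over all tries, failed ones included. In one step the sampler makes at most one random choice (a fair coin flip or a uniform integer with $9$ values) and a bounded number of elementary operations at the current node (find out what kind of node and what kind of child it is, move to its father or to a child, insert or modify nodes there, update or compare the size counter). In particular, during repointing each move from a node to its father costs one step. Then, for every $n\ge 1$, Sampler($n$) stops with probability $1$ and outputs a Motzkin tree of size $n$, and each Motzkin tree of size $n$ is output with probability $1/M_n$. Moreover the expected running time is linear: there is a constant $C$ such that, for every $n\ge1$, the expected running time of Sampler($n$) is at most $C\,n$. -/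

import Mathlib

open scoped NNReal ENNReal

namespace MotzkinSampler

/-- Motzkin trees, that is, rooted plane unary-binary trees. -/
inductive MTree : Type
  | leaf : MTree
  | unary (t : MTree) : MTree
  | binary (l r : MTree) : MTree

namespace MTree

/-- The size of a tree: its number of nodes (leaves, unary nodes and binary nodes). -/
def numNodes : MTree → ℕ
  | leaf => 1
  | unary t => t.numNodes + 1
  | binary l r => l.numNodes + r.numNodes + 1

end MTree

/-- How a non-root node hangs below its father: it is an only child, a left child (with the
subtree at its right sibling), or a right child (with the subtree at its left sibling). -/
inductive Frame : Type
  | only : Frame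
  | left (rightSibling : MTree) : Frame
  | right (leftSibling : MTree) : Frame

/-- The surroundings of a node in a tree: the frames met on the way from the node up to the root,
starting at the node. The root has the empty context. -/
abbrev Context : Type := List Frame

/-- The subtree at the father of a node, from the frame of the node and the subtree `t` at it. -/
def Frame.father : Frame → MTree → MTree
  | only, t => MTree.unary t
  | left r, t => MTree.binary t r
  | right l, t => MTree.binary l t

/-- The whole tree, from the context of a node and the subtree at this node. -/
def Context.plug : Context → MTree → MTree
  | [], t => t
  | f :: c, t => Context.plug c (f.father t)

/-- A tree with a pointed node `v`, held as the context of `v` and the subtree at `v`. In this form,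
finding out what kind of child and what kind of node `v` is, moving the point to the father or to a
child of `v`, and inserting nodes next to `v`, all take a bounded number of elementary operations. -/
structure PointedTree : Type where
  context : Context
  subtree : MTree

/-- Colour-pointed trees: a tree with a blue pointed leaf, a red pointed leaf, or a green pointed
unary node. The point is given by its context and, if it is green, by the subtree at its child. -/
inductive ColorPointedTree : Type
  | blue (c : Context) : ColorPointedTree
  | red (c : Context) : ColorPointedTree
  | green (c : Context) (child : MTree) : ColorPointedTree

/-- The underlying tree of a colour-pointed tree. -/
def ColorPointedTree.tree : ColorPointedTree → MTree
  | blue c => Context.plug c MTree.leaf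
  | red c => Context.plug c MTree.leaf
  | green c t => Context.plug c (MTree.unary t)

/-- The graft G1. A blue or red pointed leaf gets a new unary father and keeps its colour; a green
pointed unary node becomes binary, its child becomes its left child, and its right child is a new,
red pointed leaf. -/
def graft1 : ColorPointedTree → ColorPointedTree
  | .blue c => .blue (Frame.only :: c)
  | .red c => .red (Frame.only :: c)
  | .green c t => .red (Frame.right t :: c)

/-- The names of the grafts that act on a tree with a pointed node. -/
inductive Graft : Type
  | G2 | G3 | G4 | G5

/-- G2 inserts a green pointed unary node above the pointed node. The others insert a binary node
above the pointed node; its other child is a new pointed leaf: a blue right child for G3, a red left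
child for G4, a blue left child for G5. -/
def Graft.apply : Graft → PointedTree → ColorPointedTree
  | .G2, ⟨c, t⟩ => .green c t
  | .G3, ⟨c, t⟩ => .blue (Frame.right t :: c)
  | .G4, ⟨c, t⟩ => .red (Frame.left t :: c)
  | .G5, ⟨c, t⟩ => .blue (Frame.left t :: c)

/-- The number of nodes that a graft adds. -/
def Graft.added : Graft → ℕ
  | .G2 => 1
  | .G3 => 2
  | .G4 => 2
  | .G5 => 2

/-- The choice of a graft from a uniform integer with nine values: G1 (encoded as `none`) and G2
have probability 1/3 each, and G3, G4, G5 have probability 1/9 each. -/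
def chooseGraft : Fin 9 → Option Graft
  | 0 | 1 | 2 => none
  | 3 | 4 | 5 => some .G2
  | 6 => some .G3
  | 7 => some .G4
  | 8 => some .G5

/-- The random draws available in one step: a fair coin and a uniform integer with nine values. -/
abbrev Draw : Type := Bool × Fin 9

/-- The states of the sampler. The natural number `s` is the counter holding the size of the
current tree. -/
inductive State : Type
  /-- A try is about to start. -/
  | start : State
  /-- Head of the loop of a try, with current tree `T`. -/
  | loop (T : ColorPointedTree) (s : ℕ) : State
  /-- Repointing from a blue leaf: `v` moves up until it is a left child; then `g` is applied. -/
  | seekLeft (g : Graft) (v : PointedTree) (s : ℕ) : State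
  /-- Repointing from a red leaf: `v` moves up until it is a right child; then `g` is applied. -/
  | seekRight (g : Graft) (v : PointedTree) (s : ℕ) : State
  /-- A try has returned a tree (with its size), or FAIL (encoded as `none`). -/
  | returned (r : Option (ColorPointedTree × ℕ)) : State
  /-- The sampler has stopped and returns `T`. -/
  | done (T : ColorPointedTree) : State

/-- One step of the sampler for size `n`: at most one random draw and a bounded number of
elementary operations on the counter and near the point of the tree. The root counts as a right
child. -/
def step (n : ℕ) (d : Draw) : State → State
  | .start => .loop (if d.1 then .blue [] else .red []) 1
  | .loop T s =>
      if s < n then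
        match chooseGraft d.2, T with
        | none, T => .loop (graft1 T) (s + 1)
        | some g, .blue c => .seekLeft g ⟨c, MTree.leaf⟩ s
        | some g, .red c => .seekRight g ⟨c, MTree.leaf⟩ s
        | some g, .green c t => .loop (g.apply ⟨Frame.only :: c, t⟩) (s + g.added)
      else .returned (some (T, s))
  | .seekLeft _ ⟨[], _⟩ _ => .returned none
  | .seekLeft g ⟨Frame.left r :: c, t⟩ s => .loop (g.apply ⟨Frame.left r :: c, t⟩) (s + g.added)
  | .seekLeft g ⟨f :: c, t⟩ s => .seekLeft g ⟨c, f.father t⟩ s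
  | .seekRight g ⟨[], t⟩ s => .loop (g.apply ⟨[], t⟩) (s + g.added)
  | .seekRight g ⟨Frame.right l :: c, t⟩ s => .loop (g.apply ⟨Frame.right l :: c, t⟩) (s + g.added)
  | .seekRight g ⟨f :: c, t⟩ s => .seekRight g ⟨c, f.father t⟩ s
  | .returned none => .start
  | .returned (some (T, s)) => if s = n + 1 then .start else .done T
  | .done T => .done T

/-- An infinite supply of random draws, one for each step. -/
abbrev Tape : Type := ℕ → Draw

/-- The state of the sampler for size `n` after `t` steps, on the draws `ω`. -/
def stateAt (n : ℕ) (ω : Tape) : ℕ → State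
  | 0 => .start
  | t + 1 => step n (ω t) (stateAt n ω t)

/-- On the draws `ω`, the sampler for size `n` stops and outputs the tree `T` (the coloured point
of the final tree is forgotten). -/
def Outputs (n : ℕ) (ω : Tape) (T : MTree) : Prop :=
  ∃ t : ℕ, ∃ P : ColorPointedTree, stateAt n ω t = .done P ∧ P.tree = T

/-- The running time: the number of steps until the sampler stops (`⊤` if it never stops). -/
noncomputable def runningTime (n : ℕ) (ω : Tape) : ℕ∞ :=
  ⨅ (t : ℕ) (_ : ∃ P : ColorPointedTree, stateAt n ω t = .done P), (t : ℕ∞)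

/-- The law of the draws: they are independent, and each is uniform. -/
noncomputable def drawLaw : MeasureTheory.Measure Tape :=
  MeasureTheory.Measure.infinitePi fun _ : ℕ => (PMF.uniformOfFintype Draw).toMeasure

end MotzkinSampler

namespace MotzkinSampler

/-! ### Counting coloured and pointed trees -/

/-! The process can be run backwards. A coloured tree with more than one node results from exactly
one graft (`ColorPointedTree.eq_graft`, `graft1_injective`, `Graft.apply_inj`, `graft1_ne_apply`).
Repointing can also be undone: from a left child, descending through unary and right children
reaches the only blue leaf whose search arrives there; from a right child or the root, descending
through unary and left children reaches a red leaf; an only child comes from its green father. So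
each loop or seek state of size at most `n` has one predecessor. As a graft adding `k` nodes is
drawn with probability `3^(-k)`, all coloured trees of size `s ≤ n` have the same expected number of
visits, `weight s * tries n` (`runSum_loop`). Each tree of size `n` has `n + 1` colourings, so
forgetting the point preserves uniformity.

The same count bounds the visits to every seek state, so the time spent at size `s` is on average at
most a constant times `reach s * tries n`. Counting by the last graft gives the Motzkin recurrence
(`card_coloured_add_two`), which makes `reach` decay slowly enough that its partial sums are at most
`6 n * reach n` (`sum_reach_le`). A run succeeds at most once, so `reach n * tries n ≤ 1`
(`drawLaw_exits_coloured`), and the mean time is linear. A finite mean time forces almost sure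
stopping; then `reach n * tries n = 1`, and this normalisation gives the output law. -/

/-- The underlying tree of a pointed tree. -/
def PointedTree.tree (v : PointedTree) : MTree := v.context.plug v.subtree

theorem Context.numNodes_plug (c : Context) (t : MTree) :
    (Context.plug c t).numNodes + 1 = t.numNodes + (Context.plug c MTree.leaf).numNodes := by
  induction c generalizing t with
  | nil => simp [Context.plug, MTree.numNodes]
  | cons f c ih =>
    have h1 := ih (f.father t)
    have h2 := ih (f.father MTree.leaf)
    cases f <;> simp only [Context.plug, Frame.father, MTree.numNodes] at * <;> omega

theorem MTree.numNodes_pos (t : MTree) : 0 < t.numNodes := by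
  cases t <;> simp [MTree.numNodes]

theorem numNodes_tree_graft1 (P : ColorPointedTree) :
    (graft1 P).tree.numNodes = P.tree.numNodes + 1 := by
  rcases P with c | c | ⟨c, t⟩
  · have h := Context.numNodes_plug c (MTree.unary MTree.leaf)
    simp only [graft1, ColorPointedTree.tree, Context.plug, Frame.father, MTree.numNodes] at *
    omega
  · have h := Context.numNodes_plug c (MTree.unary MTree.leaf)
    simp only [graft1, ColorPointedTree.tree, Context.plug, Frame.father, MTree.numNodes] at *
    omega
  · have h := Context.numNodes_plug c (MTree.unary t)
    have h' := Context.numNodes_plug c (MTree.binary t MTree.leaf)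
    simp only [graft1, ColorPointedTree.tree, Context.plug, Frame.father, MTree.numNodes] at *
    omega

theorem numNodes_tree_apply (g : Graft) (v : PointedTree) :
    (g.apply v).tree.numNodes = v.tree.numNodes + g.added := by
  rcases v with ⟨c, t⟩
  have h := Context.numNodes_plug c t
  have h1 := Context.numNodes_plug c (MTree.unary t)
  have h2 := Context.numNodes_plug c (MTree.binary t MTree.leaf)
  have h3 := Context.numNodes_plug c (MTree.binary MTree.leaf t)
  cases g <;> simp only [Graft.apply, PointedTree.tree, ColorPointedTree.tree, Context.plug,
    Frame.father, MTree.numNodes, Graft.added] at * <;> omega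

theorem graft1_injective : Function.Injective graft1 := by
  rintro (c | c | ⟨c, t⟩) (c' | c' | ⟨c', t'⟩) h <;> simp_all [graft1]

theorem Graft.apply_inj {g g' : Graft} {v v' : PointedTree} :
    g.apply v = g'.apply v' ↔ g = g' ∧ v = v' := by
  rcases v with ⟨c, t⟩
  rcases v' with ⟨c', t'⟩
  cases g <;> cases g' <;> simp [Graft.apply] <;> tauto

/-- The colour of the point and its first frame identify the graft: a leaf that is an only child, or
a red right child, comes from G1; a green point from G2; a blue right, red left or blue left child
from G3, G4, G5. -/
theorem graft1_ne_apply (P : ColorPointedTree) (g : Graft) (v : PointedTree) :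
    graft1 P ≠ g.apply v := by
  rcases v with ⟨c, t⟩
  cases g <;> cases P <;> simp [graft1, Graft.apply]

/-- Every coloured tree is a coloured leaf, or results from a graft. -/
theorem ColorPointedTree.eq_graft (P : ColorPointedTree) :
    P = .blue [] ∨ P = .red [] ∨ (∃ Q, P = graft1 Q) ∨ ∃ (g : Graft) (v : _), P = g.apply v := by
  rcases P with (_ | ⟨_ | t | t, c⟩) | (_ | ⟨_ | t | t, c⟩) | ⟨c, t⟩
  · simp
  · exact .inr <| .inr <| .inl ⟨.blue c, rfl⟩
  · exact .inr <| .inr <| .inr ⟨.G5, ⟨c, t⟩, rfl⟩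
  · exact .inr <| .inr <| .inr ⟨.G3, ⟨c, t⟩, rfl⟩
  · simp
  · exact .inr <| .inr <| .inl ⟨.red c, rfl⟩
  · exact .inr <| .inr <| .inr ⟨.G4, ⟨c, t⟩, rfl⟩
  · exact .inr <| .inr <| .inl ⟨.green c t, rfl⟩
  · exact .inr <| .inr <| .inr ⟨.G2, ⟨c, t⟩, rfl⟩

/-- The coloured points of the tree `Context.plug c t` that lie in the subtree `t`. -/
def colourings : Context → MTree → List ColorPointedTree
  | c, .leaf => [.blue c, .red c]
  | c, .unary t => .green c t :: colourings (Frame.only :: c) t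
  | c, .binary l r => colourings (Frame.left r :: c) l ++ colourings (Frame.right l :: c) r

/-- The nodes of the tree `Context.plug c t` that lie in the subtree `t`. -/
def nodes : Context → MTree → List PointedTree
  | c, .leaf => [⟨c, .leaf⟩]
  | c, .unary t => ⟨c, .unary t⟩ :: nodes (Frame.only :: c) t
  | c, .binary l r =>
      ⟨c, .binary l r⟩ :: (nodes (Frame.left r :: c) l ++ nodes (Frame.right l :: c) r)

/-- Leaves count twice and unary nodes once; since there is one more leaf than binary nodes, the
total depends on the size alone. Uniformity on coloured trees therefore descends to trees. -/
theorem length_colourings (c : Context) (t : MTree) :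
    (colourings c t).length = t.numNodes + 1 := by
  induction t generalizing c with
  | leaf => rfl
  | unary t ih => simp [colourings, MTree.numNodes, ih]
  | binary l r ihl ihr => simp [colourings, MTree.numNodes, ihl, ihr]; omega

theorem length_nodes (c : Context) (t : MTree) : (nodes c t).length = t.numNodes := by
  induction t generalizing c with
  | leaf => rfl
  | unary t ih => simp [nodes, MTree.numNodes, ih]
  | binary l r ihl ihr => simp [nodes, MTree.numNodes, ihl, ihr]

/-- The context of the coloured point. -/
def ColorPointedTree.context : ColorPointedTree → Context
  | .blue c => c
  | .red c => c
  | .green c _ => c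

theorem suffix_of_mem_colourings {c : Context} {t : MTree} {P : ColorPointedTree}
    (h : P ∈ colourings c t) : c <:+ P.context := by
  induction t generalizing c with
  | leaf =>
    simp only [colourings, List.mem_cons, List.not_mem_nil, or_false] at h
    rcases h with rfl | rfl <;> exact List.suffix_rfl
  | unary t ih =>
    simp only [colourings, List.mem_cons] at h
    rcases h with rfl | h
    · exact List.suffix_rfl
    · exact (List.suffix_cons _ _).trans (ih h)
  | binary l r ihl ihr =>
    simp only [colourings, List.mem_append] at h
    rcases h with h | h
    · exact (List.suffix_cons _ _).trans (ihl h)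
    · exact (List.suffix_cons _ _).trans (ihr h)

theorem suffix_of_mem_nodes {c : Context} {t : MTree} {v : PointedTree}
    (h : v ∈ nodes c t) : c <:+ v.context := by
  induction t generalizing c with
  | leaf =>
    simp only [nodes, List.mem_cons, List.not_mem_nil, or_false] at h
    rcases h with rfl; exact List.suffix_rfl
  | unary t ih =>
    simp only [nodes, List.mem_cons] at h
    rcases h with rfl | h
    · exact List.suffix_rfl
    · exact (List.suffix_cons _ _).trans (ih h)
  | binary l r ihl ihr =>
    simp only [nodes, List.mem_cons, List.mem_append] at h
    rcases h with rfl | h | h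
    · exact List.suffix_rfl
    · exact (List.suffix_cons _ _).trans (ihl h)
    · exact (List.suffix_cons _ _).trans (ihr h)

theorem not_cons_suffix_self {α : Type*} (a : α) (l : List α) : ¬ (a :: l) <:+ l := by
  intro h
  have := h.length_le
  simp at this

theorem eq_of_cons_suffix {α : Type*} {a b : α} {l m : List α} (ha : (a :: l) <:+ m)
    (hb : (b :: l) <:+ m) : a = b := by
  have h := List.suffix_of_suffix_length_le ha hb (by simp)
  have := h.eq_of_length (by simp)
  simpa using this

/-- A point remembers its path to the root: points under different children have contexts ending in
different frames, and a point below a node has a strictly longer context than that node. -/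
theorem nodup_colourings (c : Context) (t : MTree) : (colourings c t).Nodup := by
  induction t generalizing c with
  | leaf => simp [colourings]
  | unary t ih =>
    refine List.nodup_cons.2 ⟨fun h => ?_, ih _⟩
    exact not_cons_suffix_self _ _ (suffix_of_mem_colourings h)
  | binary l r ihl ihr =>
    refine List.Nodup.append (ihl _) (ihr _) fun P h1 h2 => ?_
    have := eq_of_cons_suffix (suffix_of_mem_colourings h1) (suffix_of_mem_colourings h2)
    simp at this

theorem nodup_nodes (c : Context) (t : MTree) : (nodes c t).Nodup := by
  induction t generalizing c with
  | leaf => simp [nodes]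
  | unary t ih =>
    refine List.nodup_cons.2 ⟨fun h => ?_, ih _⟩
    exact not_cons_suffix_self _ _ (suffix_of_mem_nodes h)
  | binary l r ihl ihr =>
    refine List.nodup_cons.2 ⟨fun h => ?_, List.Nodup.append (ihl _) (ihr _) fun P h1 h2 => ?_⟩
    · rcases List.mem_append.1 h with h | h
      · exact not_cons_suffix_self _ _ (suffix_of_mem_nodes h)
      · exact not_cons_suffix_self _ _ (suffix_of_mem_nodes h)
    · have := eq_of_cons_suffix (suffix_of_mem_nodes h1) (suffix_of_mem_nodes h2)
      simp at this

theorem mem_colourings_plug {P : ColorPointedTree} {c : Context} {t : MTree}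
    (h : P ∈ colourings c t) : P ∈ colourings [] (Context.plug c t) := by
  induction c generalizing t with
  | nil => exact h
  | cons f c ih => refine ih ?_; cases f <;> simp [Frame.father, colourings, h]

theorem mem_nodes_plug {v : PointedTree} {c : Context} {t : MTree}
    (h : v ∈ nodes c t) : v ∈ nodes [] (Context.plug c t) := by
  induction c generalizing t with
  | nil => exact h
  | cons f c ih => refine ih ?_; cases f <;> simp [Frame.father, nodes, h]

theorem tree_of_mem_colourings {P : ColorPointedTree} {c : Context} {t : MTree}
    (h : P ∈ colourings c t) : P.tree = Context.plug c t := by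
  induction t generalizing c with
  | leaf =>
    simp only [colourings, List.mem_cons, List.not_mem_nil, or_false] at h
    rcases h with rfl | rfl <;> rfl
  | unary t ih =>
    simp only [colourings, List.mem_cons] at h
    rcases h with rfl | h
    · rfl
    · exact ih h
  | binary l r ihl ihr =>
    simp only [colourings, List.mem_append] at h
    rcases h with h | h
    · exact ihl h
    · exact ihr h

theorem tree_of_mem_nodes {v : PointedTree} {c : Context} {t : MTree}
    (h : v ∈ nodes c t) : v.tree = Context.plug c t := by
  induction t generalizing c with
  | leaf =>
    simp only [nodes, List.mem_cons, List.not_mem_nil, or_false] at h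
    rcases h with rfl; rfl
  | unary t ih =>
    simp only [nodes, List.mem_cons] at h
    rcases h with rfl | h
    · rfl
    · exact ih h
  | binary l r ihl ihr =>
    simp only [nodes, List.mem_cons, List.mem_append] at h
    rcases h with rfl | h | h
    · rfl
    · exact ihl h
    · exact ihr h

theorem mem_colourings {P : ColorPointedTree} {T : MTree} :
    P ∈ colourings [] T ↔ P.tree = T := by
  refine ⟨tree_of_mem_colourings, ?_⟩
  rintro rfl
  rcases P with c | c | ⟨c, t⟩ <;> exact mem_colourings_plug (by simp [colourings])

theorem mem_nodes {v : PointedTree} {T : MTree} : v ∈ nodes [] T ↔ v.tree = T := by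
  refine ⟨tree_of_mem_nodes, ?_⟩
  rintro rfl
  rcases v with ⟨c, t⟩
  exact mem_nodes_plug (by cases t <;> simp [nodes])

/-- Stated with `≤` so that the induction hypothesis covers both subtrees of a binary node, whose
sizes vary. -/
theorem finite_numNodes_le (n : ℕ) : {T : MTree | T.numNodes ≤ n}.Finite := by
  induction n with
  | zero =>
    convert Set.finite_empty
    ext T
    simpa using T.numNodes_pos.ne'
  | succ n ih =>
    refine (((Set.finite_singleton MTree.leaf).union (ih.image MTree.unary)).union
      (ih.image2 MTree.binary ih)).subset ?_
    rintro (_ | t | ⟨l, r⟩) h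
    · simp
    · simp only [Set.mem_ofPred_eq, MTree.numNodes] at h
      exact .inl <| .inr ⟨t, by simpa using h, rfl⟩
    · simp only [Set.mem_ofPred_eq, MTree.numNodes] at h
      exact .inr ⟨l, by simp; omega, r, by simp; omega, rfl⟩

open scoped Classical in
/-- The trees of size `n`. -/
noncomputable def treesOfSize (n : ℕ) : Finset MTree :=
  ((finite_numNodes_le n).subset fun _ (h : _ = n) => le_of_eq h :
    {T : MTree | T.numNodes = n}.Finite).toFinset

@[simp] theorem mem_treesOfSize {n : ℕ} {T : MTree} : T ∈ treesOfSize n ↔ T.numNodes = n := by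
  simp [treesOfSize]

theorem natCard_treesOfSize (n : ℕ) :
    Nat.card {T : MTree // T.numNodes = n} = (treesOfSize n).card := by
  exact Nat.subtype_card _ fun _ => mem_treesOfSize

open scoped Classical in
/-- The coloured trees with underlying tree `T`. -/
noncomputable def colouringsOf (T : MTree) : Finset ColorPointedTree := (colourings [] T).toFinset

@[simp] theorem mem_colouringsOf {P : ColorPointedTree} {T : MTree} :
    P ∈ colouringsOf T ↔ P.tree = T := by
  simp [colouringsOf, mem_colourings]

theorem card_colouringsOf (T : MTree) : (colouringsOf T).card = T.numNodes + 1 := by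
  classical
  rw [colouringsOf, List.toFinset_card_of_nodup (nodup_colourings _ _), length_colourings]

open scoped Classical in
/-- The coloured trees of size `n`. -/
noncomputable def coloured (n : ℕ) : Finset ColorPointedTree :=
  (treesOfSize n).biUnion colouringsOf

@[simp] theorem mem_coloured {n : ℕ} {P : ColorPointedTree} :
    P ∈ coloured n ↔ P.tree.numNodes = n := by
  simp [coloured]

theorem card_coloured (n : ℕ) : (coloured n).card = (n + 1) * (treesOfSize n).card := by
  classical
  rw [coloured, Finset.card_biUnion, Finset.sum_const_nat (m := n + 1), mul_comm]
  · intro T hT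
    rw [card_colouringsOf, mem_treesOfSize.1 hT]
  · intro T _ T' _ h
    refine Finset.disjoint_left.2 fun P h1 h2 => h ?_
    rw [← mem_colouringsOf.1 h1, ← mem_colouringsOf.1 h2]

open scoped Classical in
/-- The pointed trees of size `n`. -/
noncomputable def pointed (n : ℕ) : Finset PointedTree :=
  (treesOfSize n).biUnion fun T => (nodes [] T).toFinset

@[simp] theorem mem_pointed {n : ℕ} {v : PointedTree} :
    v ∈ pointed n ↔ v.tree.numNodes = n := by
  simp [pointed, mem_nodes]

theorem card_pointed (n : ℕ) : (pointed n).card = n * (treesOfSize n).card := by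
  classical
  rw [pointed, Finset.card_biUnion, Finset.sum_const_nat (m := n), mul_comm]
  · intro T hT
    rw [List.toFinset_card_of_nodup (nodup_nodes _ _), length_nodes, mem_treesOfSize.1 hT]
  · intro T _ T' _ h
    refine Finset.disjoint_left.2 fun v h1 h2 => h ?_
    rw [← mem_nodes.1 (List.mem_toFinset.1 h1), ← mem_nodes.1 (List.mem_toFinset.1 h2)]

/-- Undo the last graft: G1 leaves a coloured tree and G2 a pointed tree, both one node smaller; G3,
G4, G5 leave a pointed tree two nodes smaller. With `card_coloured` and `card_pointed` this is the
recurrence `(n+3) M_{n+2} = (2n+3) M_{n+1} + 3n M_n`. -/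
theorem card_coloured_add_two (n : ℕ) : (coloured (n + 2)).card =
    (coloured (n + 1)).card + (pointed (n + 1)).card + 3 * (pointed n).card := by
  classical
  let F : ColorPointedTree ⊕ (Graft × PointedTree) → ColorPointedTree :=
    Sum.elim graft1 fun x => x.1.apply x.2
  have hF : Function.Injective F := by
    rintro (P | ⟨g, v⟩) (P' | ⟨g', v'⟩) h
    · exact congrArg _ (graft1_injective h)
    · exact absurd h (graft1_ne_apply _ _ _)
    · exact absurd h.symm (graft1_ne_apply _ _ _)
    · obtain ⟨rfl, rfl⟩ := Graft.apply_inj.1 h; rfl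
  have key : coloured (n + 2) = ((coloured (n + 1)).disjSum
      (({Graft.G2} : Finset Graft) ×ˢ pointed (n + 1) ∪
        ({Graft.G3, Graft.G4, Graft.G5} : Finset Graft) ×ˢ pointed n)).image F := by
    ext P
    simp only [mem_coloured, Finset.mem_image, Finset.mem_disjSum, Finset.mem_union,
      Finset.mem_product, Finset.mem_singleton, Finset.mem_insert, mem_pointed]
    constructor
    · intro h
      rcases P.eq_graft with rfl | rfl | ⟨Q, rfl⟩ | ⟨g, v, rfl⟩
      · simp [ColorPointedTree.tree, Context.plug, MTree.numNodes] at h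
      · simp [ColorPointedTree.tree, Context.plug, MTree.numNodes] at h
      · rw [numNodes_tree_graft1] at h
        exact ⟨.inl Q, .inl ⟨Q, by omega, rfl⟩, rfl⟩
      · rw [numNodes_tree_apply] at h
        refine ⟨.inr (g, v), .inr ⟨_, ?_, rfl⟩, rfl⟩
        cases g <;> simp [Graft.added] at h ⊢ <;> omega
    · rintro ⟨_, ⟨Q, hQ, rfl⟩ | ⟨⟨g, v⟩, hv, rfl⟩, rfl⟩
      · simp [F, numNodes_tree_graft1, hQ]
      · simp only [F, Sum.elim_inr, numNodes_tree_apply]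
        cases g <;> simp [Graft.added] at hv ⊢ <;> omega
  rw [key, Finset.card_image_of_injective _ hF, Finset.card_disjSum, Finset.card_union_of_disjoint]
  · simp [add_assoc]
  · refine Finset.disjoint_left.2 ?_
    rintro ⟨g, v⟩ h1 h2
    simp only [Finset.mem_product, Finset.mem_singleton, Finset.mem_insert] at h1 h2
    simp [h1.1] at h2

theorem card_treesOfSize_one : (treesOfSize 1).card = 1 := by
  rw [Finset.card_eq_one]
  refine ⟨.leaf, ?_⟩
  ext (_ | t | ⟨l, r⟩)
  · simp [MTree.numNodes]
  · simpa [MTree.numNodes] using t.numNodes_pos.ne'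
  · simpa [MTree.numNodes] using fun h => absurd h l.numNodes_pos.ne'

/-! ### Growth of the number of trees -/

/-- The probability that a try visits a given coloured tree of size `n`. -/
noncomputable def weight (n : ℕ) : ℝ≥0 := 3 / 2 * (1 / 3) ^ n

/-- The probability that a try visits some coloured tree of size `n`. -/
noncomputable def reach (n : ℕ) : ℝ≥0 := (coloured n).card * weight n

theorem weight_succ (n : ℕ) : weight (n + 1) = 1 / 3 * weight n := by
  rw [weight, weight, pow_succ]; ring

theorem reach_one : reach 1 = 1 := by
  rw [reach, card_coloured, card_treesOfSize_one, weight]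
  rw [← NNReal.coe_inj]; push_cast; norm_num

theorem reach_add_two (n : ℕ) : (reach (n + 2) : ℝ) =
    1 / 3 * (1 + (n + 1) / (n + 2)) * reach (n + 1) + 1 / 3 * (n / (n + 1)) * reach n := by
  have h := card_coloured_add_two n
  have h1 := card_coloured (n + 1)
  have h2 := card_pointed (n + 1)
  have h3 := card_coloured n
  have h4 := card_pointed n
  simp only [reach, weight, h, h1, h2, h3, h4]
  push_cast
  field_simp
  ring

theorem reach_pos (n : ℕ) : 0 < reach (n + 1) := by
  induction n with
  | zero => simp [reach_one]
  | succ n ih =>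
    rw [← NNReal.coe_pos] at ih ⊢
    rw [reach_add_two]
    positivity

/-- The two bounds feed each other. Replacing the older term of the recurrence by the newer, smaller
one gives exactly the lower bound; conversely the lower bound on the ratio controls the older term
in the proof of monotonicity. -/
theorem reach_succ_bounds (n : ℕ) : (reach (n + 2) : ℝ) ≤ reach (n + 1) ∧
    (1 - 1 / 3 * (1 / (n + 1) + 1 / (n + 2))) * reach (n + 1) ≤ (reach (n + 2) : ℝ) := by
  induction n with
  | zero =>
    rw [reach_add_two]
    simp [reach_one]
    norm_num
  | succ n ih =>
    obtain ⟨h1, h2⟩ := ih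
    rw [reach_add_two (n + 1)]
    have hp : (0 : ℝ) < reach (n + 1) := by exact_mod_cast reach_pos n
    have hp' : (0 : ℝ) < reach (n + 2) := by exact_mod_cast reach_pos (n + 1)
    generalize (reach (n + 1) : ℝ) = x at *
    change _ ≤ (reach (n + 2) : ℝ) ∧ _ * (reach (n + 2) : ℝ) ≤ _ * (reach (n + 2) : ℝ) + _
    generalize (reach (n + 2) : ℝ) = y at *
    push_cast
    have hn : (0 : ℝ) ≤ n := n.cast_nonneg
    generalize (n : ℝ) = m at *
    constructor
    · have h3 : (m + 1) / (m + 2) * x ≤ (1 + 1 / (m + 3)) * y := by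
        refine le_trans ?_ (mul_le_mul_of_nonneg_left h2 (by positivity))
        rw [← mul_assoc]
        refine mul_le_mul_of_nonneg_right ?_ hp.le
        rw [← sub_nonneg]
        have : (1 + 1 / (m + 3)) * (1 - 1 / 3 * (1 / (m + 1) + 1 / (m + 2))) - (m + 1) / (m + 2)
            = ((m + 4) * (3 * (m + 1) * (m + 2) - (2 * m + 3)) - 3 * (m + 1) ^ 2 * (m + 3))
              / (3 * (m + 1) * (m + 2) * (m + 3)) := by
          field_simp
          ring
        rw [this]
        apply div_nonneg _ (by positivity)
        -- The numerator equals `4 m ^ 2 + 10 m + 3`.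
        nlinarith
      have h4 : (m + 1) / (m + 1 + 1) * x ≤ (1 + 1 / (m + 3)) * y := by
        convert h3 using 3; ring
      have h5 : (m + 1 + 1) / (m + 1 + 2) = 1 - 1 / (m + 3) := by field_simp; ring
      rw [h5]
      linarith
    · have h3 : (m + 1) / (m + 1 + 1) * y ≤ (m + 1) / (m + 1 + 1) * x :=
        mul_le_mul_of_nonneg_left h1 (by positivity)
      have h5 : (m + 1 + 1) / (m + 1 + 2) = 1 - 1 / (m + 1 + 2) := by field_simp; ring
      have h6 : (m + 1) / (m + 1 + 1) = 1 - 1 / (m + 1 + 1) := by field_simp; ring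
      rw [h5]
      rw [h6] at h3 ⊢
      linarith

/-- The ratio bound lets `reach` lose at most a factor of about `1 - 2 / (3 n)` per step, a decay of
exponent below one, so the last term dominates the average up to a constant. -/
theorem sum_reach_le (n : ℕ) :
    ∑ k ∈ Finset.range (n + 1), (reach (k + 1) : ℝ) ≤ 6 * (n + 1) * reach (n + 1) := by
  induction n with
  | zero => simp [reach_one]
  | succ n ih =>
    rw [Finset.sum_range_succ]
    have hp : (0 : ℝ) < reach (n + 1) := by exact_mod_cast reach_pos n
    obtain ⟨h1, h2⟩ := reach_succ_bounds n
    change _ + (reach (n + 2) : ℝ) ≤ 6 * _ * (reach (n + 2) : ℝ)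
    push_cast
    -- The numerator below equals `3 m ^ 2 + 5 m - 3`, negative at `m = 0`; there the sum is used
    -- directly instead of its inductive bound.
    rcases n.eq_zero_or_pos with rfl | hn
    · norm_num [reach_one] at h2 ⊢
      linarith
    refine (add_le_add_left ih _).trans ?_
    have hn : (1 : ℝ) ≤ n := by exact_mod_cast hn
    generalize (reach (n + 1) : ℝ) = x at *
    generalize (reach (n + 2) : ℝ) = y at *
    generalize (n : ℝ) = m at *
    have h3 := mul_le_mul_of_nonneg_left h2 (show (0 : ℝ) ≤ 6 * (m + 2) - 1 by linarith)
    have h4 : 6 * (m + 1) * x ≤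
        (6 * (m + 2) - 1) * ((1 - 1 / 3 * (1 / (m + 1) + 1 / (m + 2))) * x) := by
      rw [← mul_assoc]
      refine mul_le_mul_of_nonneg_right ?_ hp.le
      rw [← sub_nonneg]
      have : (6 * (m + 2) - 1) * (1 - 1 / 3 * (1 / (m + 1) + 1 / (m + 2))) - 6 * (m + 1)
          = ((6 * m + 11) * (3 * (m + 1) * (m + 2) - (2 * m + 3)) - 18 * (m + 1) ^ 2 * (m + 2))
            / (3 * (m + 1) * (m + 2)) := by
        field_simp
        ring
      rw [this]
      apply div_nonneg _ (by positivity)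
      nlinarith
    linarith

open MeasureTheory ProbabilityTheory

/-! ### Expected numbers of visits -/

instance : IsProbabilityMeasure drawLaw := by unfold drawLaw; infer_instance

/-- Factoring through finitely many draws gives measurability with no σ-algebra on `State`, and
independence of the state at time `t` from draw number `t`. -/
theorem exists_stateAt_eq (n t : ℕ) : ∃ F : (Finset.range t → Draw) → State,
    ∀ ω : Tape, stateAt n ω t = F fun i => ω i := by
  induction t with
  | zero => exact ⟨fun _ => .start, fun _ => rfl⟩
  | succ t ih =>
    obtain ⟨F, hF⟩ := ih
    refine ⟨fun x => step n (x ⟨t, by simp⟩) (F fun i => x ⟨i, ?_⟩), fun ω => ?_⟩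
    · have := Finset.mem_range.1 i.2
      exact Finset.mem_range.2 (by omega)
    · rw [stateAt, hF]

theorem measurable_stateAt {β : Type*} [MeasurableSpace β] (n t : ℕ) (f : State → β) :
    Measurable fun ω : Tape => f (stateAt n ω t) := by
  obtain ⟨F, hF⟩ := exists_stateAt_eq n t
  simp only [hF]
  exact (measurable_of_finite fun x => f (F x)).comp (by fun_prop)

theorem drawLaw_coordinate (t : ℕ) (d : Draw) : drawLaw {ω | ω t = d} = 18⁻¹ := by
  have h : drawLaw.map (fun ω => ω t) = (PMF.uniformOfFintype Draw).toMeasure :=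
    Measure.infinitePi_map_eval _ t
  have h' := Measure.map_apply (μ := drawLaw) (measurable_pi_apply t) (measurableSet_singleton d)
  rw [h, PMF.toMeasure_apply_singleton _ _ (measurableSet_singleton d)] at h'
  rw [show {ω : Tape | ω t = d} = (fun ω : Tape => ω t) ⁻¹' {d} from rfl, ← h']
  simp

/-- The expected value of `f` after one step. -/
noncomputable def stepMean (n : ℕ) (f : State → ℝ≥0∞) (σ : State) : ℝ≥0∞ :=
  ∑ d : Draw, 18⁻¹ * f (step n d σ)

/-- The Markov property: split by the value of the next draw, which is independent of the current
state. -/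
theorem lintegral_stateAt_succ (n t : ℕ) (f : State → ℝ≥0∞) :
    ∫⁻ ω, f (stateAt n ω (t + 1)) ∂drawLaw =
      ∫⁻ ω, stepMean n f (stateAt n ω t) ∂drawLaw := by
  classical
  have hind : iIndepFun (fun (i : ℕ) (ω : Tape) => ω i) drawLaw :=
    iIndepFun_infinitePi (P := fun _ : ℕ => (PMF.uniformOfFintype Draw).toMeasure)
      (X := fun _ d => d) fun _ => measurable_id
  have hind' := hind.indepFun_finset {t} (Finset.range t) (by simp) fun i => measurable_pi_apply i
  have key : ∀ d : Draw, ∫⁻ ω : Tape, (if ω t = d then 1 else 0) * f (step n d (stateAt n ω t))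
      ∂drawLaw = ∫⁻ ω : Tape, 18⁻¹ * f (step n d (stateAt n ω t)) ∂drawLaw := by
    intro d
    obtain ⟨F, hF⟩ := exists_stateAt_eq n t
    have h := hind'.comp (φ := fun x => if x ⟨t, by simp⟩ = d then (1 : ℝ≥0∞) else 0)
      (ψ := fun x => f (step n d (F x))) (measurable_of_finite _) (measurable_of_finite _)
    have hm := measurable_stateAt n t fun σ => f (step n d σ)
    have hm' : Measurable fun ω : Tape => if ω t = d then (1 : ℝ≥0∞) else 0 :=
      (measurable_of_finite fun x : Draw => if x = d then (1 : ℝ≥0∞) else 0).comp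
        (measurable_pi_apply t)
    have h' : IndepFun (fun ω : Tape => if ω t = d then (1 : ℝ≥0∞) else 0)
        (fun ω => f (step n d (stateAt n ω t))) drawLaw := by
      simp only [hF]; exact h
    have := lintegral_mul_eq_lintegral_mul_lintegral_of_indepFun hm' hm h'
    simp only [Pi.mul_apply] at this
    rw [this, lintegral_const_mul _ hm, ← drawLaw_coordinate t d]
    congr 1
    have hs : MeasurableSet {ω : Tape | ω t = d} :=
      measurableSet_preimage (f := fun ω : Tape => ω t) (measurable_pi_apply t)
        (measurableSet_singleton d)
    rw [← lintegral_indicator_one hs]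
    simp only [Set.indicator_apply, Set.mem_ofPred_eq, Pi.one_apply]
  simp only [stepMean]
  rw [lintegral_finsetSum _ fun d _ =>
    (measurable_stateAt n t fun σ => f (step n d σ)).const_mul _]
  simp only [← key]
  rw [← lintegral_finsetSum]
  · simp [stateAt]
  · intro d _
    refine Measurable.mul ?_ (measurable_stateAt n t fun σ => f (step n d σ))
    exact (measurable_of_finite fun x : Draw => if x = d then (1 : ℝ≥0∞) else 0).comp
        (measurable_pi_apply t)

/-- The expected sum of the values of `f` along a run of the sampler. -/
noncomputable def runSum (n : ℕ) (f : State → ℝ≥0∞) : ℝ≥0∞ :=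
  ∑' t, ∫⁻ ω, f (stateAt n ω t) ∂drawLaw

theorem runSum_eq (n : ℕ) (f : State → ℝ≥0∞) :
    runSum n f = f .start + runSum n (stepMean n f) := by
  rw [runSum, tsum_eq_zero_add' ENNReal.summable]
  simp only [lintegral_stateAt_succ]
  simp [runSum, stateAt]

theorem runSum_eq_lintegral (n : ℕ) (f : State → ℝ≥0∞) :
    runSum n f = ∫⁻ ω, ∑' t, f (stateAt n ω t) ∂drawLaw := by
  rw [lintegral_tsum fun t => (measurable_stateAt n t f).aemeasurable, runSum]

theorem runSum_add (n : ℕ) (f f' : State → ℝ≥0∞) :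
    runSum n (fun σ => f σ + f' σ) = runSum n f + runSum n f' := by
  simp only [runSum, lintegral_add_left (measurable_stateAt n _ f)]
  exact ENNReal.tsum_add

theorem runSum_const_mul (n : ℕ) (c : ℝ≥0∞) (f : State → ℝ≥0∞) :
    runSum n (fun σ => c * f σ) = c * runSum n f := by
  simp only [runSum, lintegral_const_mul _ (measurable_stateAt n _ f), ENNReal.tsum_mul_left]

theorem runSum_sum {ι : Type*} (n : ℕ) (s : Finset ι) (f : ι → State → ℝ≥0∞) :
    runSum n (fun σ => ∑ i ∈ s, f i σ) = ∑ i ∈ s, runSum n (f i) := by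
  simp only [runSum, lintegral_finsetSum _ fun i _ => measurable_stateAt n _ (f i)]
  exact Summable.tsum_finsetSum fun _ _ => ENNReal.summable

/-- The relations between the size counter and the current tree that hold in a run. -/
def State.Valid (n : ℕ) : State → Prop
  | .start => True
  | .loop T s => T.tree.numNodes = s ∧ s ≤ n + 1
  | .seekLeft _ v s => v.tree.numNodes = s ∧ s < n
  | .seekRight _ v s => v.tree.numNodes = s ∧ s < n
  | .returned none => True
  | .returned (some (T, s)) => T.tree.numNodes = s ∧ n ≤ s ∧ s ≤ n + 1
  | .done T => T.tree.numNodes = n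

theorem Graft.added_le (g : Graft) : g.added ≤ 2 := by cases g <;> simp [Graft.added]

theorem Graft.added_pos (g : Graft) : 0 < g.added := by cases g <;> simp [Graft.added]

theorem State.Valid.step {n : ℕ} {σ : State} (h : σ.Valid n) (d : Draw) :
    (step n d σ).Valid n := by
  have hg := fun g : Graft => g.added_le
  rcases σ with _ | ⟨T, s⟩ | ⟨g, ⟨_ | ⟨f, c⟩, t⟩, s⟩ | ⟨g, ⟨_ | ⟨f, c⟩, t⟩, s⟩ | (_ | ⟨T, s⟩) | T
  · cases hd : d.1 <;>
      simp [MotzkinSampler.step, hd, State.Valid, ColorPointedTree.tree, Context.plug,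
        MTree.numNodes]
  · obtain ⟨h1, h2⟩ := h
    simp only [MotzkinSampler.step]
    split_ifs with hs
    · split
      · refine ⟨by rw [numNodes_tree_graft1, h1], by omega⟩
      · exact ⟨h1, hs⟩
      · exact ⟨h1, hs⟩
      · rename_i g _ _ _
        refine ⟨?_, by have := hg g; omega⟩
        rw [numNodes_tree_apply, ← h1]; rfl
    · exact ⟨h1, by omega, h2⟩
  · trivial
  · obtain ⟨h1, h2⟩ := h
    cases f with
    | left r => exact ⟨by rw [numNodes_tree_apply, h1], by have := hg g; omega⟩
    | _ => exact ⟨h1, h2⟩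
  · obtain ⟨h1, h2⟩ := h
    exact ⟨by rw [numNodes_tree_apply, h1], by have := hg g; omega⟩
  · obtain ⟨h1, h2⟩ := h
    cases f with
    | right r => exact ⟨by rw [numNodes_tree_apply, h1], by have := hg g; omega⟩
    | _ => exact ⟨h1, h2⟩
  · trivial
  · obtain ⟨h1, h2, h3⟩ := h
    simp only [MotzkinSampler.step]
    split_ifs with hs
    · trivial
    · change T.tree.numNodes = n
      omega
  · exact h

theorem valid_stateAt (n : ℕ) (ω : Tape) (t : ℕ) : (stateAt n ω t).Valid n := by
  induction t with
  | zero => trivial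
  | succ t ih => exact ih.step _

theorem runSum_mono {n : ℕ} {f f' : State → ℝ≥0∞} (h : ∀ σ, σ.Valid n → f σ ≤ f' σ) :
    runSum n f ≤ runSum n f' :=
  ENNReal.tsum_le_tsum fun t => lintegral_mono fun ω => h _ (valid_stateAt n ω t)

/-! ### Uniformity of the tries -/

instance : DecidableEq Graft
  | .G2, .G2 | .G3, .G3 | .G4, .G4 | .G5, .G5 => isTrue rfl
  | .G2, .G3 | .G2, .G4 | .G2, .G5 | .G3, .G2 | .G3, .G4 | .G3, .G5
  | .G4, .G2 | .G4, .G3 | .G4, .G5 | .G5, .G2 | .G5, .G3 | .G5, .G4 => isFalse nofun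

open scoped Classical in
/-- The indicator of a state. -/
noncomputable def atState (σ' : State) (σ : State) : ℝ≥0∞ := if σ = σ' then 1 else 0

theorem stepMean_atState {n : ℕ} {σ₀ σ' : State} {p : Draw → Prop} [DecidablePred p] {c : ℝ≥0}
    (h : ∀ d σ, step n d σ = σ' ↔ σ = σ₀ ∧ p d)
    (hc : ((Finset.univ.filter p).card : ℝ≥0) = 18 * c) :
    stepMean n (atState σ') = fun σ => c * atState σ₀ σ := by
  classical
  ext σ
  simp only [stepMean, atState, h]
  by_cases hσ : σ = σ₀
  · have h18 : (18 : ℝ≥0∞)⁻¹ * 18 = 1 := ENNReal.inv_mul_cancel (by simp) (by simp)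
    have hc' : ((Finset.univ.filter p).card : ℝ≥0∞) = 18 * c := by exact_mod_cast hc
    simp only [hσ, true_and, if_true, mul_one, ← Finset.mul_sum, Finset.sum_boole, hc',
      ← mul_assoc, h18, one_mul]
  · simp [hσ]

/-- With a unique predecessor, expected visits are multiplied by the transition probability `c`. The
state `.start` is excluded because it also gets the visit at time zero. -/
theorem runSum_atState {n : ℕ} {σ₀ σ' : State} {p : Draw → Prop} [DecidablePred p] {c : ℝ≥0}
    (h : ∀ d σ, step n d σ = σ' ↔ σ = σ₀ ∧ p d)
    (hc : ((Finset.univ.filter p).card : ℝ≥0) = 18 * c) (hs : σ' ≠ .start) :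
    runSum n (atState σ') = c * runSum n (atState σ₀) := by
  rw [runSum_eq, stepMean_atState h hc, runSum_const_mul, atState, if_neg hs.symm, zero_add]

theorem runSum_atState_of_iff {n : ℕ} {σ₀ σ' : State}
    (h : ∀ d σ, step n d σ = σ' ↔ σ = σ₀) (hs : σ' ≠ .start) :
    runSum n (atState σ') = runSum n (atState σ₀) := by
  have := runSum_atState (p := fun _ => True) (c := 1) (fun d σ => by simpa using h d σ)
    (by simp) hs
  simpa using this

theorem card_chooseGraft_none :
    ((Finset.univ.filter fun d : Draw => chooseGraft d.2 = none).card : ℝ≥0) = 18 * (1 / 3) := by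
  have : (Finset.univ.filter fun d : Draw => chooseGraft d.2 = none).card = 6 := by decide
  rw [this, ← NNReal.coe_inj]; push_cast; norm_num

theorem card_chooseGraft_some (g : Graft) :
    ((Finset.univ.filter fun d : Draw => chooseGraft d.2 = some g).card : ℝ≥0) =
      18 * (1 / 3) ^ g.added := by
  have : (Finset.univ.filter fun d : Draw => chooseGraft d.2 = some g).card =
      if g = .G2 then 6 else 2 := by cases g <;> decide
  rw [this, ← NNReal.coe_inj]
  cases g <;> simp [Graft.added] <;> norm_num

/-! ### Unique predecessors of the loop and seek states. -/

theorem step_eq_graft1 {n s : ℕ} (hs : s < n) (P : ColorPointedTree) (d : Draw) (σ : State) :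
    step n d σ = .loop (graft1 P) (s + 1) ↔ σ = .loop P s ∧ chooseGraft d.2 = none := by
  have hne := fun g v => (graft1_ne_apply P g v).symm
  rcases σ with _ | ⟨T, s'⟩ | ⟨g, ⟨_ | ⟨f, c⟩, t⟩, s'⟩ | ⟨g, ⟨_ | ⟨f, c⟩, t⟩, s'⟩ | (_ | ⟨T, s'⟩) | T
  · cases hd : d.1 <;> cases P <;> simp [step, hd, graft1]
  · by_cases h : s' < n
    · rcases hd : chooseGraft d.2 with _ | g
      · simp [step, h, hd, graft1_injective.eq_iff]
      · cases T <;> simp [step, h, hd, hne]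
    · simp only [step, h, if_false]
      refine iff_of_false (by simp) ?_
      rintro ⟨h', -⟩
      simp only [State.loop.injEq] at h'
      omega
  · simp [step]
  · cases f <;> simp [step, hne]
  · simp [step, hne]
  · cases f <;> simp [step, hne]
  · simp [step]
  · simp only [step]; split_ifs <;> simp
  · simp [step]

theorem step_eq_apply_only {n s : ℕ} (hs : s < n) (g : Graft) (c : Context) (t : MTree) (d : Draw)
    (σ : State) : step n d σ = .loop (g.apply ⟨Frame.only :: c, t⟩) (s + g.added) ↔
      σ = .loop (.green c t) s ∧ chooseGraft d.2 = some g := by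
  have hne := graft1_ne_apply
  rcases σ with _ | ⟨T, s'⟩ | ⟨g', ⟨_ | ⟨f, c'⟩, t'⟩, s'⟩ | ⟨g', ⟨_ | ⟨f, c'⟩, t'⟩, s'⟩ |
    (_ | ⟨T, s'⟩) | T
  · cases hd : d.1 <;> cases g <;> simp [step, hd, Graft.apply]
  · by_cases h : s' < n
    · rcases hd : chooseGraft d.2 with _ | g'
      · simp [step, h, hd, hne]
      · cases T <;> simp [step, h, hd, Graft.apply_inj]
        grind
    · simp only [step, h, if_false]
      refine iff_of_false (by simp) ?_
      rintro ⟨h', -⟩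
      simp only [State.loop.injEq] at h'
      omega
  · simp [step]
  · cases f <;> simp [step, Graft.apply_inj]
  · simp [step, Graft.apply_inj]
  · cases f <;> simp [step, Graft.apply_inj]
  · simp [step]
  · simp only [step]; split_ifs <;> simp
  · simp [step]

/-- The state from which the graft `g` is applied to the node `v` of a tree of size `s`, when `v`
is not an only child. -/
def seekState (g : Graft) (v : PointedTree) (s : ℕ) : State :=
  match v.context with
  | Frame.left _ :: _ => .seekLeft g v s
  | _ => .seekRight g v s

/-- No condition falls on the draw, since the graft was chosen when the search began. Only children
are excluded: they are reached from a green point without a search. -/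
theorem step_eq_apply {n s : ℕ} (g : Graft) (v : PointedTree)
    (hv : ∀ c, v.context ≠ Frame.only :: c) (d : Draw) (σ : State) :
    step n d σ = .loop (g.apply v) (s + g.added) ↔ σ = seekState g v s := by
  have hne := graft1_ne_apply
  rcases v with ⟨c, t⟩
  rcases σ with _ | ⟨T, s'⟩ | ⟨g', ⟨_ | ⟨f, c'⟩, t'⟩, s'⟩ | ⟨g', ⟨_ | ⟨f, c'⟩, t'⟩, s'⟩ |
    (_ | ⟨T, s'⟩) | T
  · rcases c with _ | ⟨_ | _ | _, c⟩ <;> cases hd : d.1 <;> cases g <;>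
      simp [step, hd, Graft.apply, seekState]
  · refine iff_of_false ?_ ?_
    · by_cases h : s' < n
      · rcases hd : chooseGraft d.2 with _ | g'
        · simp [step, h, hd, hne]
        · cases T <;> simp [step, h, hd, Graft.apply_inj]
          rintro rfl rfl
          exact absurd rfl (hv _)
      · simp [step, h]
    · rcases c with _ | ⟨_ | _ | _, c⟩ <;> simp [seekState]
  · rcases c with _ | ⟨_ | _ | _, c⟩ <;> simp [step, seekState]
  · rcases c with _ | ⟨_ | _ | _, c⟩ <;> cases f <;>
      simp [step, seekState, Graft.apply_inj] <;> grind
  · rcases c with _ | ⟨_ | _ | _, c⟩ <;>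
      simp [step, seekState, Graft.apply_inj] <;> grind
  · rcases c with _ | ⟨_ | _ | _, c⟩ <;> cases f <;>
      simp [step, seekState, Graft.apply_inj] <;> grind
  · rcases c with _ | ⟨_ | _ | _, c⟩ <;> simp [step, seekState]
  · simp only [step]; rcases c with _ | ⟨_ | _ | _, c⟩ <;> split_ifs <;> simp [seekState]
  · rcases c with _ | ⟨_ | _ | _, c⟩ <;> simp [step, seekState]

theorem step_eq_seekLeft_leaf {n s : ℕ} (hs : s < n) (g : Graft) (c : Context) (d : Draw)
    (σ : State) : step n d σ = .seekLeft g ⟨c, .leaf⟩ s ↔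
      σ = .loop (.blue c) s ∧ chooseGraft d.2 = some g := by
  rcases σ with _ | ⟨T, s'⟩ | ⟨g', ⟨_ | ⟨f, c'⟩, t'⟩, s'⟩ | ⟨g', ⟨_ | ⟨f, c'⟩, t'⟩, s'⟩ |
    (_ | ⟨T, s'⟩) | T
  · simp [step]
  · by_cases h : s' < n
    · rcases hd : chooseGraft d.2 with _ | g'
      · simp [step, h, hd]
      · cases T <;> simp [step, h, hd]
        grind
    · simp only [step, h, if_false]
      refine iff_of_false (by simp) ?_
      rintro ⟨h', -⟩
      simp only [State.loop.injEq] at h'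
      omega
  · simp [step]
  · cases f <;> simp [step, Frame.father]
  · simp [step]
  · cases f <;> simp [step]
  · simp [step]
  · simp only [step]; split_ifs <;> simp
  · simp [step]

theorem step_eq_seekRight_leaf {n s : ℕ} (hs : s < n) (g : Graft) (c : Context) (d : Draw)
    (σ : State) : step n d σ = .seekRight g ⟨c, .leaf⟩ s ↔
      σ = .loop (.red c) s ∧ chooseGraft d.2 = some g := by
  rcases σ with _ | ⟨T, s'⟩ | ⟨g', ⟨_ | ⟨f, c'⟩, t'⟩, s'⟩ | ⟨g', ⟨_ | ⟨f, c'⟩, t'⟩, s'⟩ |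
    (_ | ⟨T, s'⟩) | T
  · simp [step]
  · by_cases h : s' < n
    · rcases hd : chooseGraft d.2 with _ | g'
      · simp [step, h, hd]
      · cases T <;> simp [step, h, hd]
        grind
    · simp only [step, h, if_false]
      refine iff_of_false (by simp) ?_
      rintro ⟨h', -⟩
      simp only [State.loop.injEq] at h'
      omega
  · simp [step]
  · cases f <;> simp [step]
  · simp [step]
  · cases f <;> simp [step, Frame.father]
  · simp [step]
  · simp only [step]; split_ifs <;> simp
  · simp [step]

theorem step_eq_seekLeft_father {n s : ℕ} (g : Graft) (c : Context) (t : MTree) (f : Frame)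
    (hf : ∀ r, f ≠ .left r) (d : Draw) (σ : State) :
    step n d σ = .seekLeft g ⟨c, f.father t⟩ s ↔ σ = .seekLeft g ⟨f :: c, t⟩ s := by
  rcases σ with _ | ⟨T, s'⟩ | ⟨g', ⟨_ | ⟨f', c'⟩, t'⟩, s'⟩ | ⟨g', ⟨_ | ⟨f', c'⟩, t'⟩, s'⟩ |
    (_ | ⟨T, s'⟩) | T
  · simp [step]
  · refine iff_of_false ?_ (by simp)
    by_cases h : s' < n
    · rcases hd : chooseGraft d.2 with _ | g'
      · simp [step, h, hd]
      · cases T <;> cases f <;> simp [step, h, hd, Frame.father]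
    · simp [step, h]
  · simp [step]
  · cases f' <;> cases f <;> simp [step, Frame.father] at hf ⊢ <;> grind
  · simp [step]
  · cases f' <;> simp [step]
  · simp [step]
  · simp only [step]; split_ifs <;> simp
  · simp [step]

theorem step_eq_seekRight_father {n s : ℕ} (g : Graft) (c : Context) (t : MTree) (f : Frame)
    (hf : ∀ l, f ≠ .right l) (d : Draw) (σ : State) :
    step n d σ = .seekRight g ⟨c, f.father t⟩ s ↔ σ = .seekRight g ⟨f :: c, t⟩ s := by
  rcases σ with _ | ⟨T, s'⟩ | ⟨g', ⟨_ | ⟨f', c'⟩, t'⟩, s'⟩ | ⟨g', ⟨_ | ⟨f', c'⟩, t'⟩, s'⟩ |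
    (_ | ⟨T, s'⟩) | T
  · simp [step]
  · refine iff_of_false ?_ (by simp)
    by_cases h : s' < n
    · rcases hd : chooseGraft d.2 with _ | g'
      · simp [step, h, hd]
      · cases T <;> cases f <;> simp [step, h, hd, Frame.father]
    · simp [step, h]
  · simp [step]
  · cases f' <;> simp [step]
  · simp [step]
  · cases f' <;> cases f <;> simp [step, Frame.father] at hf ⊢ <;> grind
  · simp [step]
  · simp only [step]; split_ifs <;> simp
  · simp [step]

/-- The expected number of tries. -/
noncomputable def tries (n : ℕ) : ℝ≥0∞ := runSum n (atState .start)

/-- Backwards, the search descends from `t` through unary and right children to one blue leaf. Its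
moves are deterministic, so only the initial choice of `g` contributes a factor. -/
theorem runSum_seekLeft {n s : ℕ} (hs : s < n) {x : ℝ≥0∞}
    (hx : ∀ P : ColorPointedTree, P.tree.numNodes = s → runSum n (atState (.loop P s)) = x)
    (g : Graft) (c : Context) (t : MTree) (h : (c.plug t).numNodes = s) :
    runSum n (atState (.seekLeft g ⟨c, t⟩ s)) = ((1 / 3 : ℝ≥0) ^ g.added : ℝ≥0) * x := by
  induction t generalizing c with
  | leaf =>
    rw [runSum_atState (step_eq_seekLeft_leaf hs g c) (card_chooseGraft_some g) (by simp),
      hx (.blue c) h]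
  | unary t ih =>
    exact (runSum_atState_of_iff (step_eq_seekLeft_father g c t .only (by simp)) (by simp)).trans
      (ih _ h)
  | binary l r _ ih =>
    exact (runSum_atState_of_iff (step_eq_seekLeft_father g c r (.right l) (by simp))
      (by simp)).trans (ih _ h)

theorem runSum_seekRight {n s : ℕ} (hs : s < n) {x : ℝ≥0∞}
    (hx : ∀ P : ColorPointedTree, P.tree.numNodes = s → runSum n (atState (.loop P s)) = x)
    (g : Graft) (c : Context) (t : MTree) (h : (c.plug t).numNodes = s) :
    runSum n (atState (.seekRight g ⟨c, t⟩ s)) = ((1 / 3 : ℝ≥0) ^ g.added : ℝ≥0) * x := by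
  induction t generalizing c with
  | leaf =>
    rw [runSum_atState (step_eq_seekRight_leaf hs g c) (card_chooseGraft_some g) (by simp),
      hx (.red c) h]
  | unary t ih =>
    exact (runSum_atState_of_iff (step_eq_seekRight_father g c t .only (by simp)) (by simp)).trans
      (ih _ h)
  | binary l r ih _ =>
    exact (runSum_atState_of_iff (step_eq_seekRight_father g c l (.left r) (by simp))
      (by simp)).trans (ih _ h)

theorem step_eq_loop_single (n : ℕ) (b : Bool) (d : Draw) (σ : State) :
    step n d σ = .loop (if b then .blue [] else .red []) 1 ↔ σ = .start ∧ d.1 = b := by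
  have h1 : ∀ P : ColorPointedTree, graft1 P ≠ if b then .blue [] else .red [] := by
    intro P; cases b <;> cases P <;> simp [graft1]
  have h2 : ∀ (g : Graft) (v : PointedTree), g.apply v ≠ if b then .blue [] else .red [] := by
    rintro g ⟨c, t⟩; cases b <;> cases g <;> simp [Graft.apply]
  rcases σ with _ | ⟨T, s'⟩ | ⟨g', ⟨_ | ⟨f', c'⟩, t'⟩, s'⟩ | ⟨g', ⟨_ | ⟨f', c'⟩, t'⟩, s'⟩ |
    (_ | ⟨T, s'⟩) | T
  · cases hd : d.1 <;> cases b <;> simp [step, hd]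
  · refine iff_of_false ?_ (by simp)
    by_cases h : s' < n
    · rcases hd : chooseGraft d.2 with _ | g'
      · simp [step, h, hd, h1]
      · cases T <;> simp [step, h, hd, h2]
    · simp [step, h]
  · simp [step]
  · cases f' <;> simp [step, h2]
  · simp [step, h2]
  · cases f' <;> simp [step, h2]
  · simp [step]
  · simp only [step]; split_ifs <;> simp
  · simp [step]

theorem runSum_loop_single (n : ℕ) (b : Bool) :
    runSum n (atState (.loop (if b then .blue [] else .red []) 1)) = weight 1 * tries n := by
  refine runSum_atState (step_eq_loop_single n b) ?_ (by simp)
  have : (Finset.univ.filter fun d : Draw => d.1 = b).card = 9 := by cases b <;> decide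
  rw [this, weight, ← NNReal.coe_inj]; push_cast; norm_num

theorem weight_add (s k : ℕ) : weight (s + k) = (1 / 3) ^ k * weight s := by
  rw [weight, weight, pow_add]; ring

/-- Undoing the last graft costs a factor `1/3` per removed node, whichever graft it was. At size `n
+ 1` this breaks down, as the loop ends at size `n` and one-node grafts cannot lead there. -/
theorem runSum_loop {n s : ℕ} (hs : s ≤ n) (P : ColorPointedTree) (hP : P.tree.numNodes = s) :
    runSum n (atState (.loop P s)) = weight s * tries n := by
  induction s using Nat.strong_induction_on generalizing P with
  | _ s ih =>
  rcases P.eq_graft with rfl | rfl | ⟨Q, rfl⟩ | ⟨g, v, rfl⟩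
  · obtain rfl : s = 1 := hP.symm
    exact runSum_loop_single n true
  · obtain rfl : s = 1 := hP.symm
    exact runSum_loop_single n false
  · rw [numNodes_tree_graft1] at hP
    subst hP
    rw [runSum_atState (step_eq_graft1 (by omega) Q) card_chooseGraft_none (by simp),
      ih _ (by omega) (by omega) Q rfl, weight_succ, ENNReal.coe_mul, mul_assoc]
  · rw [numNodes_tree_apply] at hP
    have hg := g.added_pos
    have hlt : v.tree.numNodes < n := by omega
    have ih' := ih v.tree.numNodes (by omega) hlt.le
    subst hP
    rw [weight_add, ENNReal.coe_mul, mul_assoc]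
    by_cases hv : ∀ c, v.context ≠ Frame.only :: c
    · rw [runSum_atState_of_iff (step_eq_apply g v hv) (by simp)]
      rcases v with ⟨_ | ⟨_ | r | l, c⟩, t⟩
      · exact runSum_seekRight hlt ih' g _ t rfl
      · exact absurd rfl (hv c)
      · exact runSum_seekLeft hlt ih' g _ t rfl
      · exact runSum_seekRight hlt ih' g _ t rfl
    · push Not at hv
      obtain ⟨c, hc⟩ := hv
      rcases v with ⟨_, t⟩
      subst hc
      rw [runSum_atState (step_eq_apply_only hlt g c t) (card_chooseGraft_some g) (by simp),
        ih' (.green c t) rfl]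

/-! ### The output -/

open scoped Classical in
theorem sum_atState {α : Type*} {F : α → State} (hF : Function.Injective F) (A : Finset α)
    (σ : State) : ∑ a ∈ A, atState (F a) σ = if ∃ a ∈ A, σ = F a then 1 else 0 := by
  split_ifs with h
  · obtain ⟨a, ha, rfl⟩ := h
    simp [atState, hF.eq_iff, ha]
  · push Not at h
    exact Finset.sum_eq_zero fun a ha => if_neg (h a ha)

theorem stateAt_eq_returned_of_done {n : ℕ} {ω : Tape} {t : ℕ} {P : ColorPointedTree}
    (h : stateAt n ω t = .done P) : ∃ t', stateAt n ω t' = .returned (some (P, n)) := by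
  induction t with
  | zero => simp [stateAt] at h
  | succ t ih =>
    have hv := valid_stateAt n ω t
    rw [stateAt] at h
    rcases hσ : stateAt n ω t with _ | ⟨T, s⟩ | ⟨g, ⟨_ | ⟨f, c⟩, t⟩, s⟩ | ⟨g, ⟨_ | ⟨f, c⟩, t⟩, s⟩ |
      (_ | ⟨T, s⟩) | T
    · simp [hσ, step] at h
    · by_cases hs : s < n
      · rcases hd : chooseGraft (ω t).2 with _ | g
        · simp [hσ, step, hs, hd] at h
        · cases T <;> simp [hσ, step, hs, hd] at h
      · simp [hσ, step, hs] at h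
    · simp [hσ, step] at h
    · cases f <;> simp [hσ, step] at h
    · simp [hσ, step] at h
    · cases f <;> simp [hσ, step] at h
    · simp [hσ, step] at h
    · rw [hσ] at hv h
      obtain ⟨-, h1, h2⟩ := hv
      by_cases hs : s = n + 1
      · simp [step, hs] at h
      · obtain rfl : s = n := by omega
        simp only [step, hs, if_false, State.done.injEq] at h
        exact ⟨t, by rw [hσ, h]⟩
    · rw [hσ] at h
      exact ih (hσ.trans h)

theorem stateAt_eq_done_of_lt {n : ℕ} {ω : Tape} {t t' : ℕ} {P : ColorPointedTree}
    (h : stateAt n ω t = .returned (some (P, n))) (ht : t < t') : stateAt n ω t' = .done P := by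
  induction t', ht using Nat.le_induction with
  | base => simp [stateAt, h, step]
  | succ t' _ ih => simp [stateAt, ih, step]

/-- The sampler is about to stop, and its current coloured tree belongs to `A`. -/
def Exits (n : ℕ) (A : Finset ColorPointedTree) (σ : State) : Prop :=
  ∃ P ∈ A, σ = .returned (some (P, n))

/-- A successful return occurs at most once in a run, so its probability is an expected number of
visits. The absorbing state `.done` would not serve, being visited forever. -/
theorem drawLaw_exits {n : ℕ} (A : Finset ColorPointedTree)
    (hA : ∀ P ∈ A, P.tree.numNodes = n) :
    drawLaw {ω | ∃ t, Exits n A (stateAt n ω t)} = A.card * (weight n * tries n) := by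
  classical
  have h1 : ∀ t, MeasurableSet {ω | Exits n A (stateAt n ω t)} := fun t =>
    measurableSet_setOfPred.2 (measurable_stateAt n t _)
  have h2 : Pairwise (Function.onFun Disjoint fun t => {ω | Exits n A (stateAt n ω t)}) := by
    have key : ∀ t t', t < t' → ∀ ω, Exits n A (stateAt n ω t) →
        ¬ Exits n A (stateAt n ω t') := by
      rintro t t' ht ω ⟨P, _, hP⟩ ⟨P', _, hP'⟩
      rw [stateAt_eq_done_of_lt hP ht] at hP'
      simp at hP'
    intro t t' ht
    refine Set.disjoint_left.2 fun ω h h' => ?_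
    rcases ht.lt_or_gt with ht | ht
    · exact key _ _ ht ω h h'
    · exact key _ _ ht ω h' h
  have hinj : Function.Injective fun P : ColorPointedTree => State.returned (some (P, n)) := by
    intro P P' h; simpa using h
  calc drawLaw {ω | ∃ t, Exits n A (stateAt n ω t)}
      = drawLaw (⋃ t, {ω | Exits n A (stateAt n ω t)}) := by congr 1; ext; simp
    _ = ∑' t, drawLaw {ω | Exits n A (stateAt n ω t)} := measure_iUnion h2 h1
    _ = runSum n fun σ => ∑ P ∈ A, atState (.returned (some (P, n))) σ := by
      refine tsum_congr fun t => ?_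
      rw [← lintegral_indicator_one (h1 t)]
      refine lintegral_congr fun ω => ?_
      refine Eq.trans ?_ (sum_atState hinj A _).symm
      simp [Set.indicator_apply, Exits]
    _ = ∑ P ∈ A, (weight n * tries n : ℝ≥0∞) := by
      rw [runSum_sum]
      refine Finset.sum_congr rfl fun P hP => ?_
      rw [← runSum_loop le_rfl P (hA P hP)]
      refine runSum_atState_of_iff (fun d σ => ?_) (by simp)
      rcases σ with _ | ⟨T, s⟩ | ⟨g, ⟨_ | ⟨f, c⟩, t⟩, s⟩ | ⟨g, ⟨_ | ⟨f, c⟩, t⟩, s⟩ |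
        (_ | ⟨T, s⟩) | T
      · simp [step]
      · by_cases hs : s < n
        · rcases hd : chooseGraft d.2 with _ | g
          · simp [step, hs, hd, hs.ne]
          · cases T <;> simp [step, hs, hd, hs.ne]
        · simp [step, hs]
      · simp [step]
      · cases f <;> simp [step]
      · simp [step]
      · cases f <;> simp [step]
      · simp [step]
      · simp only [step]; split_ifs <;> simp
      · simp [step]
    _ = A.card * (weight n * tries n) := by simp

theorem drawLaw_outputs {n : ℕ} {T : MTree} (hT : T.numNodes = n) :
    drawLaw {ω | Outputs n ω T} = (n + 1 : ℕ) * (weight n * tries n) := by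
  have : {ω | Outputs n ω T} = {ω | ∃ t, Exits n (colouringsOf T) (stateAt n ω t)} := by
    ext ω
    constructor
    · rintro ⟨t, P, hP, rfl⟩
      obtain ⟨t', h⟩ := stateAt_eq_returned_of_done hP
      exact ⟨t', P, by simp, h⟩
    · rintro ⟨t, P, hP, h⟩
      exact ⟨t + 1, P, stateAt_eq_done_of_lt h (Nat.lt_succ_self t), mem_colouringsOf.1 hP⟩
  rw [this, drawLaw_exits, card_colouringsOf, hT]
  intro P hP
  rw [mem_colouringsOf.1 hP, hT]

theorem drawLaw_exits_coloured (n : ℕ) :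
    drawLaw {ω | ∃ t, Exits n (coloured n) (stateAt n ω t)} = reach n * tries n := by
  rw [drawLaw_exits _ fun P hP => mem_coloured.1 hP, reach, ENNReal.coe_mul, mul_assoc]
  simp

/-! ### The running time -/

/-- The indicator of the states in which a try starts, tests its loop condition with a positive
answer, or repoints. -/
noncomputable def active (n : ℕ) : State → ℝ≥0∞
  | .start => 1
  | .loop _ s => if s < n then 1 else 0
  | .seekLeft _ _ _ => 1
  | .seekRight _ _ _ => 1
  | .returned _ => 0
  | .done _ => 0

/-- The indicator of the states in which a try leaves its loop. -/
noncomputable def leaving (n : ℕ) : State → ℝ≥0∞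
  | .loop _ s => if s < n then 0 else 1
  | _ => 0

/-- The indicator of the states in which a try has returned. -/
noncomputable def hasReturned : State → ℝ≥0∞
  | .returned _ => 1
  | _ => 0

/-- The indicator of the states in which the sampler has not stopped. -/
noncomputable def running : State → ℝ≥0∞
  | .done _ => 0
  | _ => 1

theorem running_eq (n : ℕ) (σ : State) :
    running σ = active n σ + leaving n σ + hasReturned σ := by
  cases σ <;> simp [running, active, leaving, hasReturned]
  split_ifs <;> simp

theorem stepMean_le {n : ℕ} {f : State → ℝ≥0∞} {σ : State} {x : ℝ≥0∞}
    (h : ∀ d, f (step n d σ) ≤ x) : stepMean n f σ ≤ x := by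
  have h18 : (18 : ℝ≥0∞) * 18⁻¹ = 1 := ENNReal.mul_inv_cancel (by simp) (by simp)
  refine (Finset.sum_le_sum fun d _ => mul_le_mul_right (h d) _).trans ?_
  rw [Finset.sum_const, show (Finset.univ : Finset Draw).card = 18 from rfl, nsmul_eq_mul,
    ← mul_assoc]
  push_cast
  rw [h18, one_mul]

theorem runSum_leaving_le (n : ℕ) : runSum n (leaving n) ≤ runSum n (active n) := by
  rw [runSum_eq, show leaving n .start = 0 from rfl, zero_add]
  refine runSum_mono fun σ _ => stepMean_le fun d => ?_
  have h1 : ∀ σ, leaving n σ ≤ 1 := by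
    intro σ; cases σ <;> simp [leaving]; split_ifs <;> simp
  rcases σ with _ | ⟨T, s⟩ | _ | _ | (_ | ⟨T, s⟩) | T
  · exact h1 _
  · by_cases hs : s < n
    · simpa [active, hs] using h1 _
    · simp [step, hs, leaving]
  · exact h1 _
  · exact h1 _
  · simp [step, leaving]
  · simp only [step]; split_ifs <;> simp [leaving]
  · simp [step, leaving]

theorem runSum_hasReturned_le (n : ℕ) :
    runSum n hasReturned ≤ runSum n (active n) + runSum n (leaving n) := by
  rw [runSum_eq, show hasReturned .start = 0 from rfl, zero_add, ← runSum_add]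
  refine runSum_mono fun σ _ => stepMean_le fun d => ?_
  have h1 : ∀ σ, hasReturned σ ≤ 1 := by intro σ; cases σ <;> simp [hasReturned]
  rcases σ with _ | ⟨T, s⟩ | _ | _ | (_ | ⟨T, s⟩) | T
  · simpa [active, leaving] using h1 _
  · refine (h1 _).trans ?_
    by_cases hs : s < n <;> simp [active, leaving, hs]
  · simpa [active, leaving] using h1 _
  · simpa [active, leaving] using h1 _
  · simp [step, hasReturned]
  · simp only [step]; split_ifs <;> simp [hasReturned]
  · simp [step, hasReturned]

/-- Bookkeeping steps are charged to their predecessors: leaving costs at most one active total,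
returning at most two, so `4 = 1 + 1 + 2`. -/
theorem runSum_running_le (n : ℕ) : runSum n running ≤ 4 * runSum n (active n) := by
  have h1 := runSum_leaving_le n
  have h2 := runSum_hasReturned_le n
  rw [show running = fun σ => active n σ + leaving n σ + hasReturned σ from
    funext (running_eq n), runSum_add, runSum_add]
  calc _ ≤ runSum n (active n) + runSum n (active n) +
        (runSum n (active n) + runSum n (active n)) :=
        add_le_add (add_le_add le_rfl h1) (h2.trans (add_le_add le_rfl h1))
    _ = _ := by ring

/-- The names of the grafts other than G1. -/
def grafts : Finset Graft := {.G2, .G3, .G4, .G5}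

theorem active_le {n : ℕ} {σ : State} (h : σ.Valid n) : active n σ ≤ atState .start σ +
    ∑ s ∈ Finset.range n, (∑ P ∈ coloured s, atState (.loop P s) σ +
      ∑ g ∈ grafts, ∑ v ∈ pointed s,
        (atState (.seekLeft g v s) σ + atState (.seekRight g v s) σ)) := by
  rcases σ with _ | ⟨T, s⟩ | ⟨g, v, s⟩ | ⟨g, v, s⟩ | r | T
  · simp [active, atState]
  · by_cases hs : s < n
    · simp only [active, hs, if_true]
      refine le_add_left ((?_ : (1 : ℝ≥0∞) ≤ _).trans (Finset.single_le_sum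
        (fun _ _ => zero_le) (Finset.mem_range.2 hs)))
      refine le_add_right ((?_ : (1 : ℝ≥0∞) ≤ _).trans (Finset.single_le_sum
        (fun _ _ => zero_le) (mem_coloured.2 h.1)))
      simp [atState]
    · simp [active, hs]
  · refine le_add_left ((?_ : (1 : ℝ≥0∞) ≤ _).trans (Finset.single_le_sum
      (fun _ _ => zero_le) (Finset.mem_range.2 h.2)))
    refine le_add_left ((?_ : (1 : ℝ≥0∞) ≤ _).trans (Finset.single_le_sum
      (fun _ _ => zero_le) (show g ∈ grafts by cases g <;> decide)))
    refine (?_ : (1 : ℝ≥0∞) ≤ _).trans (Finset.single_le_sum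
      (fun _ _ => zero_le) (mem_pointed.2 h.1))
    simp [atState]
  · refine le_add_left ((?_ : (1 : ℝ≥0∞) ≤ _).trans (Finset.single_le_sum
      (fun _ _ => zero_le) (Finset.mem_range.2 h.2)))
    refine le_add_left ((?_ : (1 : ℝ≥0∞) ≤ _).trans (Finset.single_le_sum
      (fun _ _ => zero_le) (show g ∈ grafts by cases g <;> decide)))
    refine (?_ : (1 : ℝ≥0∞) ≤ _).trans (Finset.single_le_sum
      (fun _ _ => zero_le) (mem_pointed.2 h.1))
    simp [atState]
  · simp [active]
  · simp [active]

theorem runSum_seek_le {n s : ℕ} (hs : s < n) (g : Graft) {v : PointedTree}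
    (hv : v.tree.numNodes = s) :
    runSum n (fun σ => atState (.seekLeft g v s) σ + atState (.seekRight g v s) σ) ≤
      2 * (weight s * tries n) := by
  have h := runSum_loop hs.le
  have h3 : (((1 / 3 : ℝ≥0) ^ g.added : ℝ≥0) : ℝ≥0∞) ≤ 1 := by
    norm_cast
    refine pow_le_one₀ zero_le ?_
    rw [← NNReal.coe_le_coe]; push_cast; norm_num
  have h4 := mul_le_mul_left h3 ((weight s : ℝ≥0∞) * tries n)
  rw [one_mul] at h4
  rw [runSum_add, two_mul]
  refine add_le_add ?_ ?_
  · exact (runSum_seekLeft hs h g v.context v.subtree hv).le.trans h4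
  · exact (runSum_seekRight hs h g v.context v.subtree hv).le.trans h4

theorem card_pointed_le (s : ℕ) : (pointed s).card ≤ (coloured s).card := by
  rw [card_pointed, card_coloured]
  exact Nat.mul_le_mul_right _ (Nat.le_succ s)

/-- At each size, `9 = 1 + 4 * 2`: the loop head, and four grafts in two search directions. Each
node carries at most one coloured tree's share of visits per graft and direction, which pays for
long climbs. -/
theorem runSum_active_le (n : ℕ) :
    runSum n (active n) ≤ (1 + 9 * ∑ s ∈ Finset.range n, (reach s : ℝ≥0∞)) * tries n := by
  refine (runSum_mono fun σ hσ => active_le hσ).trans ?_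
  rw [runSum_add, runSum_sum, add_mul, one_mul, Finset.mul_sum, Finset.sum_mul]
  refine add_le_add le_rfl (Finset.sum_le_sum fun s hs => ?_)
  have hs := Finset.mem_range.1 hs
  rw [runSum_add, runSum_sum, runSum_sum]
  have h1 : ∑ P ∈ coloured s, runSum n (atState (.loop P s)) = reach s * tries n := by
    rw [Finset.sum_congr rfl fun P hP => runSum_loop hs.le P (mem_coloured.1 hP),
      Finset.sum_const, nsmul_eq_mul, reach, ENNReal.coe_mul, mul_assoc]
    simp
  have h2 : ∀ g ∈ grafts, runSum n (fun σ => ∑ v ∈ pointed s,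
      (atState (.seekLeft g v s) σ + atState (.seekRight g v s) σ)) ≤
        2 * (reach s * tries n) := by
    intro g _
    rw [runSum_sum]
    refine (Finset.sum_le_sum fun v hv => runSum_seek_le hs g (mem_pointed.1 hv)).trans ?_
    rw [Finset.sum_const, nsmul_eq_mul, reach, ENNReal.coe_mul, ENNReal.coe_natCast,
      mul_left_comm, mul_assoc]
    gcongr
    exact card_pointed_le s
  rw [h1]
  refine (add_le_add le_rfl (Finset.sum_le_sum h2)).trans ?_
  rw [Finset.sum_const, show grafts.card = 4 from rfl, nsmul_eq_mul]
  refine le_of_eq ?_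
  push_cast
  ring

theorem runSum_running_le_linear {n : ℕ} (hn : 1 ≤ n) : runSum n running ≤ 240 * n := by
  obtain ⟨m, rfl⟩ : ∃ m, n = m + 1 := ⟨n - 1, by omega⟩
  have hsum : ∑ k ∈ Finset.range (m + 1), reach (k + 1) ≤ 6 * (m + 1) * reach (m + 1) := by
    have := sum_reach_le m
    exact_mod_cast this
  have h0 : reach 0 = 0 := by
    have : coloured 0 = ∅ := Finset.eq_empty_of_forall_notMem fun P hP =>
      P.tree.numNodes_pos.ne' (mem_coloured.1 hP)
    simp [reach, this]
  have h1 : 1 ≤ 6 * (m + 1) * reach (m + 1) := by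
    refine le_trans ?_ hsum
    rw [← reach_one]
    exact Finset.single_le_sum (f := fun k => reach (k + 1)) (fun _ _ => zero_le)
      (Finset.mem_range.2 m.succ_pos)
  have h2 : ∑ s ∈ Finset.range (m + 1), reach s ≤ 6 * (m + 1) * reach (m + 1) := by
    rw [Finset.sum_range_succ', h0, add_zero]
    refine le_trans (Finset.sum_le_sum_of_subset ?_) hsum
    exact Finset.range_subset_range.2 m.le_succ
  -- `60 = 6 + 9 * 6`.
  have h3 : 1 + 9 * ∑ s ∈ Finset.range (m + 1), reach s ≤ 60 * (m + 1) * reach (m + 1) :=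
    (add_le_add h1 (mul_le_mul_right h2 9)).trans (by ring_nf; rfl)
  have h3' : (1 + 9 * ∑ s ∈ Finset.range (m + 1), (reach s : ℝ≥0∞)) ≤
      60 * (m + 1) * reach (m + 1) := by exact_mod_cast h3
  -- The product is a probability; this also rules out an infinite `tries`, not known to be finite
  -- before.
  have h4 : reach (m + 1) * tries (m + 1) ≤ 1 := by
    rw [← drawLaw_exits_coloured]; exact prob_le_one
  calc runSum (m + 1) running ≤ 4 * runSum (m + 1) (active (m + 1)) := runSum_running_le _
    _ ≤ 4 * (60 * (m + 1) * reach (m + 1) * tries (m + 1)) := by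
      gcongr
      exact (runSum_active_le _).trans (by gcongr)
    _ = 240 * (m + 1) * (reach (m + 1) * tries (m + 1)) := by ring
    _ ≤ 240 * (m + 1) * 1 := by gcongr
    _ = 240 * (m + 1 : ℕ) := by push_cast; ring

/-! ### From the mean running time to almost sure stopping and the output law. -/

theorem running_eq_one {σ : State} (h : ¬ ∃ P, σ = .done P) : running σ = 1 := by
  cases σ <;> simp_all [running]

theorem runningTime_le (n : ℕ) (ω : Tape) :
    (runningTime n ω : ℝ≥0∞) ≤ ∑' t, running (stateAt n ω t) := by
  classical
  by_cases h : ∃ t P, stateAt n ω t = .done P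
  · have h1 : runningTime n ω ≤ (Nat.find h : ℕ∞) := by
      unfold runningTime
      exact iInf₂_le (Nat.find h) (Nat.find_spec h)
    calc (runningTime n ω : ℝ≥0∞) ≤ ((Nat.find h : ℕ∞) : ℝ≥0∞) := by exact_mod_cast h1
      _ = ∑ t ∈ Finset.range (Nat.find h), running (stateAt n ω t) := by
        rw [Finset.sum_congr rfl fun t ht =>
          running_eq_one (Nat.find_min h (Finset.mem_range.1 ht))]
        simp
      _ ≤ _ := ENNReal.sum_le_tsum _
  · push Not at h
    have : ∀ t, running (stateAt n ω t) = 1 := fun t => running_eq_one fun ⟨P, hP⟩ => h t P hP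
    simp [this]

/-- A run that never stops would make the sum of `running` infinite, which the finite mean forbids
almost surely; validity of the final state gives the size. -/
theorem ae_outputs {n : ℕ} (hn : 1 ≤ n) :
    ∀ᵐ ω ∂drawLaw, ∃ T : MTree, T.numNodes = n ∧ Outputs n ω T := by
  have h := (runSum_eq_lintegral n running).symm.trans_le (runSum_running_le_linear hn)
  have hm : Measurable fun ω : Tape => ∑' t, running (stateAt n ω t) :=
    Measurable.tsum fun t => measurable_stateAt n t running
  filter_upwards [ae_lt_top hm (h.trans_lt (by finiteness)).ne] with ω hω
  by_contra hne
  refine hω.ne ?_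
  have : ∀ t, running (stateAt n ω t) = 1 := fun t => running_eq_one fun ⟨P, hP⟩ => by
    have hv := valid_stateAt n ω t
    rw [hP] at hv
    exact hne ⟨P.tree, hv, t, P, hP, rfl⟩
  simp [this]

theorem reach_mul_tries {n : ℕ} (hn : 1 ≤ n) : reach n * tries n = 1 := by
  rw [← drawLaw_exits_coloured, ← measure_univ (μ := drawLaw)]
  refine measure_congr (Filter.eventuallyEq_set.2 ?_)
  filter_upwards [ae_outputs hn] with ω hω
  obtain ⟨T, hT, t, P, hP, rfl⟩ := hω
  obtain ⟨t', h⟩ := stateAt_eq_returned_of_done hP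
  exact iff_of_true ⟨t', P, mem_coloured.2 hT, h⟩ trivial

theorem drawLaw_outputs_eq_inv {n : ℕ} (hn : 1 ≤ n) {T : MTree} (hT : T.numNodes = n) :
    drawLaw {ω | Outputs n ω T} =
      ((Nat.card {T' : MTree // T'.numNodes = n} : ℕ) : ℝ≥0∞)⁻¹ := by
  rw [drawLaw_outputs hT, natCard_treesOfSize]
  refine ENNReal.eq_inv_of_mul_eq_one_left ?_
  rw [← reach_mul_tries hn, reach, card_coloured]
  push_cast
  ring

end MotzkinSampler

theorem mainTheorem3 :
    (∀ n : ℕ, 1 ≤ n →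
      (∀ᵐ ω ∂MotzkinSampler.drawLaw,
        ∃ T : MotzkinSampler.MTree, T.numNodes = n ∧ MotzkinSampler.Outputs n ω T) ∧
      ∀ T : MotzkinSampler.MTree, T.numNodes = n →
        MotzkinSampler.drawLaw {ω | MotzkinSampler.Outputs n ω T} =
          ((Nat.card {T' : MotzkinSampler.MTree // T'.numNodes = n} : ℕ) : ℝ≥0∞)⁻¹) ∧
    ∃ C : ℝ≥0, ∀ n : ℕ, 1 ≤ n →
      ∫⁻ ω, (MotzkinSampler.runningTime n ω : ℝ≥0∞) ∂MotzkinSampler.drawLaw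
        ≤ (C : ℝ≥0∞) * (n : ℝ≥0∞) := by
  refine ⟨fun n hn => ⟨MotzkinSampler.ae_outputs hn, fun T hT =>
    MotzkinSampler.drawLaw_outputs_eq_inv hn hT⟩, 240, fun n hn => ?_⟩
  refine (MeasureTheory.lintegral_mono fun ω => MotzkinSampler.runningTime_le n ω).trans ?_
  rw [← MotzkinSampler.runSum_eq_lintegral]
  exact_mod_cast MotzkinSampler.runSum_running_le_linear hn
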